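/- Let $n,k,l$ be integers with $2\le k<l<n$, and let $s_i=(i,i+1)$, $1\le i\le n-1$, be the simple transpositions of the symmetric group $\mathfrak S_n$. Then the expression $$s_ks_{k-1}\,s_{k+1}s_k\cdots s_ls_{l-1}$$ (the concatenation of the pairs $s_js_{j-1}$ for $j=k,k+1,\dots,l$) is reduced. Let $w_{k,l}\in\mathfrak S_n$ be its product. The Kazhdan–Lusztig polynomial $P_{e,w_{k,l}}$, where $e$ is the identity, is $$P_{e,w_{k,l}}=F_{l-k+1}(q),$$ where the $q$-Fibonacci numbers are the polynomials given by $F_0(q)=F_1(q)=1$ and $F_m(q)=F_{m-1}(q)+q\,F_{m-2}(q)$ for $m\ge 2$. Here the Kazhdan–Lusztig polynomials are normalized as follows. The Hecke algebra $\mathcal H$ of $\mathfrak S_n$ over $\mathbb Q(q^{1/2})$ has basis $(T_w)_{w\in\mathfrak S_n}$, with $T_sT_w=T_{sw}$ if $l(sw)>l(w)$ and $T_s^2=(q-1)T_s+qT_e$ for simple transpositions $s$, where $l$ is the length. Its involution is $\iota\bigl(\sum_w\alpha_wT_w\bigr)=\sum_w\overline{\alpha_w}\,(T_{w^{-1}})^{-1}$,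 where the bar is the field automorphism with $\overline{q^{1/2}}=q^{-1/2}$. For $w\in\mathfrak S_n$ the family $(P_{x,w})_{x\in\mathfrak S_n}$ is the unique family of polynomials in $q$ such that $P_{w,w}=1$; $\deg P_{x,w}\le\frac12(l(w)-l(x)-1)$ for $x<w$ in the Bruhat order; $P_{x,w}=0$ if $x\not\le w$; and $q^{-l(w)/2}\sum_{x\le w}P_{x,w}T_x$ is fixed by $\iota$. -/

import Mathlib

namespace KazhdanLusztig

open Polynomial

noncomputable section

/-! ### The symmetric group with its simple transpositions

The letters `1, …, n` are represented by the elements `0, …, n - 1` of `Fin n`; products of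
permutations are compositions of maps. -/

/-- The simple transposition `s_i = (i, i + 1)` of the letters `1, …, n`, for `1 ≤ i < n`.
(Only indices in this range are ever used.) -/
def simple (n i : ℕ) : Equiv.Perm (Fin n) :=
  if h : 1 ≤ i ∧ i < n then Equiv.swap ⟨i - 1, by omega⟩ ⟨i, h.2⟩ else 1

/-- A list `[i₁, …, i_r]` encodes an expression `s_{i₁} ⋯ s_{i_r}` if all indices lie in
`{1, …, n - 1}`. -/
def IsExpression (n : ℕ) (L : List ℕ) : Prop := ∀ i ∈ L, 1 ≤ i ∧ i < n

/-- The product `s_{i₁} ⋯ s_{i_r}` in the symmetric group. -/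
def wordProd (n : ℕ) (L : List ℕ) : Equiv.Perm (Fin n) := (L.map (simple n)).prod

/-- The length: the least `r` such that `w` is a product of `r` simple transpositions. -/
def length {n : ℕ} (w : Equiv.Perm (Fin n)) : ℕ :=
  sInf {r | ∃ L : List ℕ, IsExpression n L ∧ wordProd n L = w ∧ L.length = r}

/-- `L` is a reduced expression for `w`. -/
def IsReducedExpression {n : ℕ} (w : Equiv.Perm (Fin n)) (L : List ℕ) : Prop :=
  IsExpression n L ∧ wordProd n L = w ∧ L.length = length w

/-- The Bruhat–Chevalley order: every reduced expression for `w` has a subexpression whose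
product is `x`. -/
def BruhatLE {n : ℕ} (x w : Equiv.Perm (Fin n)) : Prop :=
  ∀ L : List ℕ, IsReducedExpression w L → ∃ L' : List ℕ, L'.Sublist L ∧ wordProd n L' = x

section Aux

variable {n : ℕ}

theorem simple_mul_self (i : ℕ) : simple n i * simple n i = 1 := by
  unfold simple; split_ifs <;> simp

theorem simple_inv (i : ℕ) : (simple n i)⁻¹ = simple n i :=
  inv_eq_of_mul_eq_one_left (simple_mul_self i)

theorem simple_mul_cancel (i : ℕ) (w : Equiv.Perm (Fin n)) :
    simple n i * (simple n i * w) = w := by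
  rw [← mul_assoc, simple_mul_self, one_mul]

theorem mul_simple_cancel (i : ℕ) (w : Equiv.Perm (Fin n)) :
    w * simple n i * simple n i = w := by
  rw [mul_assoc, simple_mul_self, mul_one]

theorem simple_eq {i : ℕ} (h : 1 ≤ i ∧ i < n) :
    simple n i = Equiv.swap ⟨i - 1, by omega⟩ ⟨i, h.2⟩ := by
  unfold simple; rw [dif_pos h]

theorem wordProd_nil : wordProd n [] = 1 := rfl

theorem wordProd_cons (i : ℕ) (L : List ℕ) :
    wordProd n (i :: L) = simple n i * wordProd n L := by
  simp [wordProd]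

theorem wordProd_append (L L' : List ℕ) :
    wordProd n (L ++ L') = wordProd n L * wordProd n L' := by
  simp [wordProd]

theorem wordProd_reverse (L : List ℕ) : wordProd n L.reverse = (wordProd n L)⁻¹ := by
  induction L with
  | nil => simp [wordProd_nil]
  | cons i L ih =>
    rw [List.reverse_cons, wordProd_append, ih, wordProd_cons, wordProd_cons, wordProd_nil,
      mul_inv_rev, simple_inv, mul_one]

theorem exists_expression (w : Equiv.Perm (Fin n)) :
    ∃ L : List ℕ, IsExpression n L ∧ wordProd n L = w := by
  rcases n with _ | m
  · exact ⟨[], by simp [IsExpression], Subsingleton.elim _ _⟩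
  have hw : w ∈ Submonoid.closure
      (Set.range fun i : Fin m => Equiv.swap i.castSucc i.succ) := by
    rw [Equiv.Perm.mclosure_swap_castSucc_succ]; trivial
  induction hw using Submonoid.closure_induction with
  | mem x hx =>
    obtain ⟨i, rfl⟩ := hx
    have hi : 1 ≤ (i : ℕ) + 1 ∧ (i : ℕ) + 1 < m + 1 := by omega
    refine ⟨[(i : ℕ) + 1], by simp [IsExpression], ?_⟩
    rw [wordProd_cons, wordProd_nil, mul_one, simple_eq hi]
    rfl
  | one => exact ⟨[], by simp [IsExpression], rfl⟩
  | mul x y _ _ hx hy =>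
    obtain ⟨L, hL, rfl⟩ := hx
    obtain ⟨L', hL', rfl⟩ := hy
    refine ⟨L ++ L', ?_, wordProd_append L L'⟩
    intro i hi
    rcases List.mem_append.1 hi with h | h
    exacts [hL i h, hL' i h]

theorem exists_reducedExpression (w : Equiv.Perm (Fin n)) :
    ∃ L : List ℕ, IsReducedExpression w L := by
  obtain ⟨L, hL, hw⟩ := exists_expression w
  have := Nat.sInf_mem (s := {r | ∃ L : List ℕ, IsExpression n L ∧ wordProd n L = w ∧
    L.length = r}) ⟨L.length, L, hL, hw, rfl⟩
  exact this

theorem length_le {w : Equiv.Perm (Fin n)} {L : List ℕ} (hL : IsExpression n L)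
    (hw : wordProd n L = w) : length w ≤ L.length :=
  Nat.sInf_le ⟨L, hL, hw, rfl⟩

theorem length_inv_le (w : Equiv.Perm (Fin n)) : length w⁻¹ ≤ length w := by
  obtain ⟨L, hL, rfl, hl⟩ := exists_reducedExpression w
  rw [← hl, ← List.length_reverse]
  exact length_le (fun i hi => hL i (List.mem_reverse.1 hi)) (wordProd_reverse L)

theorem length_inv (w : Equiv.Perm (Fin n)) : length w⁻¹ = length w :=
  le_antisymm (length_inv_le w) (by simpa using length_inv_le w⁻¹)

theorem simple_lt_simple {i : ℕ} (hi : 1 ≤ i ∧ i < n) {x y : Fin n} (hxy : x < y)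
    (h : Equiv.swap x y ≠ simple n i) : simple n i x < simple n i y := by
  rw [simple_eq hi] at h ⊢
  have hne : ¬ ((x : ℕ) = i - 1 ∧ (y : ℕ) = i) := by
    rintro ⟨h1, h2⟩
    apply h
    congr 1 <;> exact Fin.ext (by assumption)
  simp only [Equiv.swap_apply_def, Fin.ext_iff] at hxy ⊢
  rw [Fin.lt_def] at hxy ⊢
  split_ifs <;> (try simp only []) <;> omega

/-- The exchange property of the symmetric group. -/
theorem exists_shorter (L : List ℕ) (hL : IsExpression n L) {x y : Fin n} (hxy : x < y)
    (h : (wordProd n L)⁻¹ y < (wordProd n L)⁻¹ x) :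
    ∃ L' : List ℕ, IsExpression n L' ∧ L'.length < L.length ∧
      wordProd n L' = Equiv.swap x y * wordProd n L := by
  induction L generalizing x y with
  | nil => simp only [wordProd_nil, inv_one, Equiv.Perm.one_apply] at h; omega
  | cons i L ih =>
    have hi := hL i (by simp)
    have hL' : IsExpression n L := fun j hj => hL j (by simp [hj])
    by_cases hs : Equiv.swap x y = simple n i
    · refine ⟨L, hL', by simp, ?_⟩
      rw [hs, wordProd_cons, simple_mul_cancel]
    · rw [wordProd_cons, mul_inv_rev, simple_inv] at h
      obtain ⟨L', h1, h2, h3⟩ := ih hL' (simple_lt_simple hi hxy hs) h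
      refine ⟨i :: L', ?_, by simpa using h2, ?_⟩
      · intro j hj
        rcases List.mem_cons.1 hj with rfl | hj
        exacts [hi, h1 j hj]
      · rw [wordProd_cons, h3, wordProd_cons, Equiv.swap_apply_apply, simple_inv]
        simp only [mul_assoc, simple_mul_cancel]

theorem length_simple_mul_lt {i : ℕ} (hi : 1 ≤ i ∧ i < n) (w : Equiv.Perm (Fin n))
    (h : w⁻¹ ⟨i, hi.2⟩ < w⁻¹ ⟨i - 1, by omega⟩) : length (simple n i * w) < length w := by
  obtain ⟨L, hL, rfl, hl⟩ := exists_reducedExpression w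
  obtain ⟨L', h1, h2, h3⟩ := exists_shorter L hL
    (x := ⟨i - 1, by omega⟩) (y := ⟨i, hi.2⟩) (by rw [Fin.lt_def]; simp only []; omega) h
  rw [← simple_eq hi] at h3
  exact lt_of_le_of_lt (length_le h1 h3) (hl ▸ h2)

/-- Left descents in terms of positions. -/
theorem length_lt_simple_mul_iff {i : ℕ} (hi : 1 ≤ i ∧ i < n) (w : Equiv.Perm (Fin n)) :
    length w < length (simple n i * w) ↔ w⁻¹ ⟨i - 1, by omega⟩ < w⁻¹ ⟨i, hi.2⟩ := by
  constructor
  · intro h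
    rcases lt_trichotomy (w⁻¹ ⟨i - 1, by omega⟩) (w⁻¹ ⟨i, hi.2⟩) with h' | h' | h'
    · exact h'
    · have := congrArg Fin.val (w⁻¹.injective h')
      simp only [] at this
      omega
    · exact absurd (length_simple_mul_lt hi w h') (by omega)
  · intro h
    have := length_simple_mul_lt hi (simple n i * w) (by
      rw [mul_inv_rev, simple_inv, Equiv.Perm.mul_apply, Equiv.Perm.mul_apply, simple_eq hi,
        Equiv.swap_apply_left, Equiv.swap_apply_right]
      exact h)
    rwa [simple_mul_cancel] at this

theorem length_mul_simple (i : ℕ) (w : Equiv.Perm (Fin n)) :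
    length (w * simple n i) = length (simple n i * w⁻¹) := by
  rw [← length_inv, mul_inv_rev, simple_inv]

/-- If `s w ≠ w t` then `s` is an ascent of `w t` exactly when it is an ascent of `w`. -/
theorem ascent_mul_simple_iff {i j : ℕ} (hi : 1 ≤ i ∧ i < n) (hj : 1 ≤ j ∧ j < n)
    (w : Equiv.Perm (Fin n)) (hne : simple n i * w ≠ w * simple n j) :
    length (w * simple n j) < length (simple n i * (w * simple n j)) ↔
      length w < length (simple n i * w) := by
  have key : ∀ v : Equiv.Perm (Fin n), simple n i * v ≠ v * simple n j →
      length v < length (simple n i * v) →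
      length (v * simple n j) < length (simple n i * (v * simple n j)) := by
    intro v hv h
    rw [length_lt_simple_mul_iff hi] at h ⊢
    rw [mul_inv_rev, simple_inv, Equiv.Perm.mul_apply, Equiv.Perm.mul_apply]
    refine simple_lt_simple hj h ?_
    rw [Equiv.swap_apply_apply, ← simple_eq hi, inv_inv]
    intro h'
    apply hv
    rw [← h']
    group
  constructor
  · intro h
    have := key (w * simple n j) (by
      rw [mul_simple_cancel]
      intro h'
      apply hne
      have h2 := congrArg (simple n i * ·) h'
      simp only [simple_mul_cancel] at h2
      exact h2.symm) h
    rwa [mul_simple_cancel] at this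
  · exact key w hne

/-- If `s w ≠ w t` then `t` is an ascent of `s w` exactly when it is an ascent of `w`. -/
theorem ascent_simple_mul_iff {i j : ℕ} (hi : 1 ≤ i ∧ i < n) (hj : 1 ≤ j ∧ j < n)
    (w : Equiv.Perm (Fin n)) (hne : simple n i * w ≠ w * simple n j) :
    length (simple n i * w) < length (simple n i * w * simple n j) ↔
      length w < length (w * simple n j) := by
  have := ascent_mul_simple_iff hj hi w⁻¹ (by
    intro h
    apply hne
    have h2 := congrArg (·⁻¹) h
    simpa [mul_inv_rev, simple_inv] using h2.symm)
  rw [length_mul_simple j (simple n i * w), length_mul_simple j w, mul_inv_rev, simple_inv,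
    ← length_inv (simple n i * w), mul_inv_rev, simple_inv, ← length_inv w]
  exact this

theorem length_eq_zero {w : Equiv.Perm (Fin n)} (h : length w = 0) : w = 1 := by
  obtain ⟨L, -, rfl, hl⟩ := exists_reducedExpression w
  rw [h, List.length_eq_zero_iff] at hl
  rw [hl, wordProd_nil]

/-- Every permutation other than the identity has a left descent. -/
theorem exists_left_descent {w : Equiv.Perm (Fin n)} (hw : w ≠ 1) :
    ∃ i : ℕ, (1 ≤ i ∧ i < n) ∧ ∃ v : Equiv.Perm (Fin n), w = simple n i * v ∧
      length v < length (simple n i * v) := by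
  obtain ⟨L, hL, hp, hl⟩ := exists_reducedExpression w
  rcases L with _ | ⟨i, L⟩
  · exact absurd hp.symm hw
  · refine ⟨i, hL i (by simp), wordProd n L, ?_, ?_⟩
    · rw [← hp, wordProd_cons]
    · rw [← wordProd_cons, hp, ← hl]
      exact lt_of_le_of_lt (length_le (fun j hj => hL j (by simp [hj])) rfl) (by simp)

theorem induction_left {p : Equiv.Perm (Fin n) → Prop} (h1 : p 1)
    (h : ∀ i v, (1 ≤ i ∧ i < n) → length v < length (simple n i * v) → p v →
      p (simple n i * v)) (w : Equiv.Perm (Fin n)) : p w := by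
  induction hr : length w using Nat.strong_induction_on generalizing w with
  | _ r ih =>
    by_cases hw : w = 1
    · exact hw ▸ h1
    · obtain ⟨i, hi, v, rfl, hv⟩ := exists_left_descent hw
      exact h i v hi hv (ih _ (hr ▸ hv) v rfl)

theorem induction_right {p : Equiv.Perm (Fin n) → Prop} (h1 : p 1)
    (h : ∀ i v, (1 ≤ i ∧ i < n) → length v < length (v * simple n i) → p v →
      p (v * simple n i)) (w : Equiv.Perm (Fin n)) : p w := by
  have := induction_left (p := fun w => p w⁻¹) (by simpa using h1) (by
    intro i v hi hv hp
    rw [mul_inv_rev, simple_inv]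
    refine h i v⁻¹ hi ?_ hp
    rw [length_mul_simple, inv_inv, length_inv]
    exact hv) w⁻¹
  simpa using this

theorem length_one : length (1 : Equiv.Perm (Fin n)) = 0 :=
  Nat.le_zero.1 (length_le (L := []) (by simp [IsExpression]) rfl)

theorem length_simple {i : ℕ} (hi : 1 ≤ i ∧ i < n) : length (simple n i) = 1 := by
  have h1 : length (simple n i) ≤ 1 :=
    length_le (L := [i]) (by simpa [IsExpression] using hi) (by simp [wordProd])
  have h2 := (length_lt_simple_mul_iff hi 1).2 (by
    rw [inv_one, Equiv.Perm.one_apply, Equiv.Perm.one_apply, Fin.lt_def]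
    simp only []
    omega)
  rw [mul_one, length_one] at h2
  omega

end Aux

/-! ### The Hecke algebra

The Hecke algebra acts faithfully on its left regular module, the free module on the symmetric
group; it is built as the algebra of operators on this module that is generated by the left
multiplications with the `T_s`, `s` a simple transposition. Here the ground ring `R` is an arbitrary
commutative ring and `q` any element of it; the Kazhdan–Lusztig polynomials use
`R = ℚ(q^{1/2})`. -/

/-- The free `R`-module on the symmetric group. -/
abbrev FreeMod (n : ℕ) (R : Type*) [CommRing R] := Equiv.Perm (Fin n) → R

/-- The basis vector of the free module that belongs to `w`. -/
def vec {n : ℕ} (R : Type*) [CommRing R] (w : Equiv.Perm (Fin n)) : FreeMod n R :=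
  Pi.basisFun R (Equiv.Perm (Fin n)) w

/-- The left multiplication by `T_s`, `s = s_i`: it maps `T_w` to `T_{sw}` if `l(sw) > l(w)`, and
to `(q - 1) T_w + q T_{sw}` otherwise. -/
def leftOp (n : ℕ) {R : Type*} [CommRing R] (q : R) (i : ℕ) : Module.End R (FreeMod n R) :=
  (Pi.basisFun R (Equiv.Perm (Fin n))).constr R fun w =>
    if length w < length (simple n i * w) then vec R (simple n i * w)
    else (q - 1) • vec R w + q • vec R (simple n i * w)

/-- The right multiplication by `T_s`, `s = s_i` (used only to study the left one). -/
def rightOp (n : ℕ) {R : Type*} [CommRing R] (q : R) (i : ℕ) : Module.End R (FreeMod n R) :=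
  (Pi.basisFun R (Equiv.Perm (Fin n))).constr R fun w =>
    if length w < length (w * simple n i) then vec R (w * simple n i)
    else (q - 1) • vec R w + q • vec R (w * simple n i)

/-- The algebra of operators generated by the left multiplications with the `T_s`. -/
def heckeSubalgebra (n : ℕ) {R : Type*} [CommRing R] (q : R) :
    Subalgebra R (Module.End R (FreeMod n R)) :=
  Algebra.adjoin R {f | ∃ i : ℕ, (1 ≤ i ∧ i < n) ∧ f = leftOp n q i}

/-- The Hecke algebra of the symmetric group over `R` with parameter `q`. -/
def Hecke (n : ℕ) {R : Type*} [CommRing R] (q : R) := ↥(heckeSubalgebra n q)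

instance (n : ℕ) {R : Type*} [CommRing R] (q : R) : Ring (Hecke n q) :=
  inferInstanceAs (Ring (heckeSubalgebra n q))

instance (n : ℕ) {R : Type*} [CommRing R] (q : R) : Algebra R (Hecke n q) :=
  inferInstanceAs (Algebra R (heckeSubalgebra n q))

section AuxHecke

variable {n : ℕ} {R : Type*} [CommRing R] {q : R}

theorem leftOp_single (q : R) (i : ℕ) (w : Equiv.Perm (Fin n)) :
    leftOp n q i (vec R w) =
      if length w < length (simple n i * w) then vec R (simple n i * w)
      else (q - 1) • vec R w + q • vec R (simple n i * w) := by
  unfold leftOp; exact Module.Basis.constr_basis _ _ _ _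

theorem rightOp_single (q : R) (i : ℕ) (w : Equiv.Perm (Fin n)) :
    rightOp n q i (vec R w) =
      if length w < length (w * simple n i) then vec R (w * simple n i)
      else (q - 1) • vec R w + q • vec R (w * simple n i) := by
  unfold rightOp; exact Module.Basis.constr_basis _ _ _ _

theorem end_ext {f g : Module.End R (FreeMod n R)}
    (h : ∀ w : Equiv.Perm (Fin n), f (vec R w) = g (vec R w)) : f = g :=
  (Pi.basisFun R (Equiv.Perm (Fin n))).ext h

theorem leftOp_rightOp {i j : ℕ} (hi : 1 ≤ i ∧ i < n) (hj : 1 ≤ j ∧ j < n) :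
    leftOp n q i * rightOp n q j = rightOp n q j * leftOp n q i := by
  refine end_ext fun w => ?_
  rw [Module.End.mul_apply, Module.End.mul_apply, leftOp_single, rightOp_single]
  by_cases he : simple n i * w = w * simple n j
  · have e1 : simple n i * (w * simple n j) = w := by rw [← he, simple_mul_cancel]
    have e2 : simple n i * w * simple n j = w := by rw [he, mul_simple_cancel]
    by_cases h : length w < length (w * simple n j)
    · have h' : length w < length (simple n i * w) := he ▸ h
      rw [if_pos h, if_pos h', leftOp_single, rightOp_single, e1, e2, he]
    · have h' : ¬ length w < length (simple n i * w) := he ▸ h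
      rw [if_neg h, if_neg h']
      simp only [map_add, map_smul, leftOp_single, rightOp_single, e1, e2, if_neg h, if_neg h']
      rw [he]
  · have h1 := ascent_mul_simple_iff hi hj w he
    have h2 := ascent_simple_mul_iff hi hj w he
    simp only [← mul_assoc] at h1
    by_cases hl : length w < length (simple n i * w) <;>
    by_cases hr : length w < length (w * simple n j)
    · rw [if_pos hl, if_pos hr, leftOp_single, rightOp_single, ← mul_assoc, if_pos (h1.2 hl),
        if_pos (h2.2 hr)]
    · rw [if_pos hl, if_neg hr, map_add, map_smul, map_smul, leftOp_single, leftOp_single,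
        rightOp_single, ← mul_assoc, if_pos (h1.2 hl), if_pos hl, if_neg (mt h2.1 hr)]
    · rw [if_neg hl, if_pos hr, map_add, map_smul, map_smul, rightOp_single, rightOp_single,
        leftOp_single, ← mul_assoc, if_neg (mt h1.1 hl), if_pos hr, if_pos (h2.2 hr)]
    · rw [if_neg hl, if_neg hr, map_add, map_smul, map_smul, map_add, map_smul, map_smul,
        leftOp_single, leftOp_single, rightOp_single, rightOp_single, ← mul_assoc,
        if_neg (mt h1.1 hl), if_neg hl, if_neg hr, if_neg (mt h2.1 hr)]
      module

theorem commute_rightOp {f : Module.End R (FreeMod n R)} (hf : f ∈ heckeSubalgebra n q) {j : ℕ}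
    (hj : 1 ≤ j ∧ j < n) : f * rightOp n q j = rightOp n q j * f := by
  induction hf using Algebra.adjoin_induction with
  | mem f hf =>
    obtain ⟨i, hi, rfl⟩ := hf
    exact leftOp_rightOp hi hj
  | algebraMap r => exact Algebra.commutes r _
  | add f g _ _ hf hg => rw [add_mul, mul_add, hf, hg]
  | mul f g _ _ hf hg => rw [mul_assoc, hg, ← mul_assoc, hf, mul_assoc]

/-- Evaluation of an operator at the basis vector of the identity. -/
def evalOne (n : ℕ) (q : R) : Hecke n q →ₗ[R] FreeMod n R where
  toFun f := f.1 (vec R 1)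
  map_add' _ _ := rfl
  map_smul' _ _ := rfl

theorem evalOne_apply (f : Hecke n q) : evalOne n q f = f.1 (vec R 1) := rfl

theorem evalOne_mul (f g : Hecke n q) : evalOne n q (f * g) = f.1 (evalOne n q g) := rfl

theorem evalOne_injective : Function.Injective (evalOne n q) := by
  rw [injective_iff_map_eq_zero]
  intro f hf
  rw [evalOne_apply] at hf
  refine Subtype.ext (end_ext fun w => ?_)
  change f.1 (vec R w) = 0
  induction w using induction_right with
  | h1 => exact hf
  | h i v hi hv ih =>
    have h1 : vec R (v * simple n i) = rightOp n q i (vec R v) := by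
      rw [rightOp_single, if_pos hv]
    rw [h1, ← Module.End.mul_apply, commute_rightOp f.2 hi, Module.End.mul_apply, ih, map_zero]

/-- The generator `T_s`, `s = s_i`. -/
def gen (q : R) {i : ℕ} (hi : 1 ≤ i ∧ i < n) : Hecke n q :=
  ⟨leftOp n q i, Algebra.subset_adjoin ⟨i, hi, rfl⟩⟩

theorem exists_evalOne_eq (w : Equiv.Perm (Fin n)) :
    ∃ f : Hecke n q, evalOne n q f = vec R w := by
  induction w using induction_left with
  | h1 => exact ⟨1, rfl⟩
  | h i v hi hv ih =>
    obtain ⟨f, hf⟩ := ih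
    refine ⟨gen q hi * f, ?_⟩
    rw [evalOne_mul, hf]
    exact (leftOp_single q i v).trans (if_pos hv)

theorem evalOne_surjective : Function.Surjective (evalOne n q) := by
  rw [← LinearMap.range_eq_top, ← top_le_iff,
    ← (Pi.basisFun R (Equiv.Perm (Fin n))).span_eq, Submodule.span_le]
  rintro _ ⟨w, rfl⟩
  exact exists_evalOne_eq w

end AuxHecke

/-- The standard basis `T_w` of the Hecke algebra: `T_w` is the operator that maps the basis
vector of the identity to the basis vector of `w`. -/
def T (n : ℕ) {R : Type*} [CommRing R] (q : R) : Module.Basis (Equiv.Perm (Fin n)) R (Hecke n q) :=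
  (Pi.basisFun R (Equiv.Perm (Fin n))).map
    (LinearEquiv.ofBijective (evalOne n q) ⟨evalOne_injective, evalOne_surjective⟩).symm

section AuxT

variable {n : ℕ} {R : Type*} [CommRing R] {q : R}

theorem evalOne_T (w : Equiv.Perm (Fin n)) : evalOne n q (T n q w) = vec R w :=
  (LinearEquiv.ofBijective (evalOne n q)
    ⟨evalOne_injective, evalOne_surjective⟩).apply_symm_apply (vec R w)

theorem T_one : T n q 1 = 1 := evalOne_injective (evalOne_T 1)

theorem T_simple {i : ℕ} (hi : 1 ≤ i ∧ i < n) : T n q (simple n i) = gen q hi := by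
  apply evalOne_injective
  rw [evalOne_T, evalOne_apply]
  change _ = leftOp n q i (vec R 1)
  rw [leftOp_single, if_pos, mul_one]
  rw [mul_one, length_one, length_simple hi]
  exact one_pos

/-- First defining relation: `T_s T_w = T_{sw}` if `l(sw) > l(w)`. -/
theorem T_simple_mul {i : ℕ} (hi : 1 ≤ i ∧ i < n) {w : Equiv.Perm (Fin n)}
    (h : length w < length (simple n i * w)) :
    T n q (simple n i) * T n q w = T n q (simple n i * w) := by
  apply evalOne_injective
  rw [evalOne_T, T_simple hi, evalOne_mul, evalOne_T]
  exact (leftOp_single q i w).trans (if_pos h)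

/-- Second defining relation: `T_s² = (q - 1) T_s + q T_e`. -/
theorem T_simple_sq {i : ℕ} (hi : 1 ≤ i ∧ i < n) :
    T n q (simple n i) ^ 2 = (q - 1) • T n q (simple n i) + q • T n q 1 := by
  apply evalOne_injective
  rw [map_add, map_smul, map_smul, evalOne_T, evalOne_T, pow_two]
  rw [evalOne_mul, evalOne_T, T_simple hi]
  refine (leftOp_single q i _).trans ?_
  rw [if_neg, simple_mul_self]
  rw [simple_mul_self, length_one]
  omega

/-- The basis elements `T_w` are invertible if `q` is. -/
theorem isUnit_T (hq : IsUnit q) (w : Equiv.Perm (Fin n)) : IsUnit (T n q w) := by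
  obtain ⟨u, hu⟩ := hq.exists_left_inv
  have hs : ∀ i, (1 ≤ i ∧ i < n) → IsUnit (T n q (simple n i)) := by
    intro i hi
    have h := T_simple_sq (q := q) hi
    rw [T_one] at h
    have h3 : T n q (simple n i) * T n q (simple n i) - (q - 1) • T n q (simple n i) =
        q • (1 : Hecke n q) := by rw [← pow_two, h, add_sub_cancel_left]
    have h1 : T n q (simple n i) * (u • (T n q (simple n i) - (q - 1) • 1)) = 1 := by
      rw [mul_smul_comm, mul_sub, mul_smul_comm, mul_one, h3, smul_smul, hu, one_smul]
    have h2 : (u • (T n q (simple n i) - (q - 1) • 1)) * T n q (simple n i) = 1 := by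
      rw [smul_mul_assoc, sub_mul, smul_mul_assoc, one_mul, h3, smul_smul, hu, one_smul]
    exact ⟨⟨_, _, h1, h2⟩, rfl⟩
  induction w using induction_left with
  | h1 => rw [T_one]; exact isUnit_one
  | h i v hi hv ih => rw [← T_simple_mul hi hv]; exact (hs i hi).mul ih

end AuxT

/-! ### The ground field `ℚ(q^{1/2})` and its involution -/

/-- The field `ℚ(q^{1/2})`. -/
abbrev A : Type := RatFunc ℚ

/-- The element `q^{1/2}`. -/
def qHalf : A := RatFunc.X

/-- The element `q`. -/
def q : A := qHalf ^ 2

theorem qHalf_ne_zero : qHalf ≠ 0 := RatFunc.X_ne_zero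

theorem q_ne_zero : q ≠ 0 := pow_ne_zero _ qHalf_ne_zero

theorem eval₂_X_inv_injective (K : Type) [Field K] :
    Function.Injective (Polynomial.eval₂RingHom (RatFunc.C (K := K)) (RatFunc.X)⁻¹) := by
  have h : Transcendental K ((RatFunc.X : RatFunc K)⁻¹) := fun h =>
    RatFunc.transcendental_X (K := K) (IsAlgebraic.inv_iff.1 h)
  exact transcendental_iff_injective.1 h

/-- The involution of `ℚ(q^{1/2})` with `q^{1/2} ↦ q^{-1/2}`. -/
def bar : A →+* A :=
  RatFunc.liftRingHom (Polynomial.eval₂RingHom RatFunc.C qHalf⁻¹)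
    (nonZeroDivisors_le_comap_nonZeroDivisors_of_injective _ (eval₂_X_inv_injective ℚ))

theorem bar_qHalf : bar qHalf = qHalf⁻¹ := by
  have := RatFunc.liftRingHom_apply_div (Polynomial.eval₂RingHom RatFunc.C qHalf⁻¹)
    (nonZeroDivisors_le_comap_nonZeroDivisors_of_injective _ (eval₂_X_inv_injective ℚ))
    (Polynomial.X : ℚ[X]) 1
  simp [bar, qHalf]

/-- The involution of the Hecke algebra: `∑ α_w T_w ↦ ∑ \bar α_w (T_{w⁻¹})⁻¹`. -/
def iota {n : ℕ} (h : Hecke n q) : Hecke n q :=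
  ∑ w : Equiv.Perm (Fin n), bar ((T n q).repr h w) • Ring.inverse (T n q w⁻¹)

/-! ### Kazhdan–Lusztig polynomials -/

open Classical in
/-- The element `q^{-l(w)/2} ∑_{x ≤ w} P_x(q) T_x`. -/
def klElement {n : ℕ} (w : Equiv.Perm (Fin n)) (P : Equiv.Perm (Fin n) → ℚ[X]) : Hecke n q :=
  (qHalf ^ length w)⁻¹ •
    ∑ x : Equiv.Perm (Fin n) with BruhatLE x w, (P x).eval₂ RatFunc.C q • T n q x

/-- The conditions that characterize the family `x ↦ P_{x,w}` for a fixed `w`: the polynomial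
`P_{x,w}` in `q` has degree at most `(l(w) - l(x) - 1) / 2` for `x < w`, `P_{w,w} = 1`,
`P_{x,w} = 0` if `x ≰ w`, and the element `C'_w = q^{-l(w)/2} ∑_{x ≤ w} P_{x,w} T_x` is fixed by
the involution. -/
structure IsKLFamily {n : ℕ} (w : Equiv.Perm (Fin n)) (P : Equiv.Perm (Fin n) → ℚ[X]) :
    Prop where
  self : P w = 1
  degree_le : ∀ x, BruhatLE x w → x ≠ w → 2 * (P x).natDegree + length x + 1 ≤ length w
  eq_zero : ∀ x, ¬ BruhatLE x w → P x = 0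
  iota_eq : iota (klElement w P) = klElement w P

open Classical in
/-- The Kazhdan–Lusztig polynomial `P_{x,w}`: the value at `x` of the unique family that satisfies
the characterizing conditions. (If there were not exactly one such family, the value would be `0`;
so a nonzero value expresses in particular that the family exists and is unique.) -/
def klPoly {n : ℕ} (x w : Equiv.Perm (Fin n)) : ℚ[X] :=
  if h : ∃! P : Equiv.Perm (Fin n) → ℚ[X], IsKLFamily w P then h.choose x else 0

/-! ### The permutations `w_{k,l}` and the `q`-Fibonacci numbers -/

/-- The `q`-Fibonacci numbers: `F_0 = F_1 = 1` and `F_m = F_{m-1} + q F_{m-2}` for `m ≥ 2`. -/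
def qFib : ℕ → ℚ[X]
  | 0 => 1
  | 1 => 1
  | m + 2 => qFib (m + 1) + X * qFib m

/-- The expression `s_k s_{k-1} s_{k+1} s_k ⋯ s_l s_{l-1}`, the concatenation of the pairs
`s_j s_{j-1}` for `j = k, k + 1, …, l`. -/
def haimanWord (k l : ℕ) : List ℕ := (List.range' k (l + 1 - k)).flatMap fun j => [j, j - 1]

end

end KazhdanLusztig

/-! Each `q^{-1/2}(1 + T_s)` is fixed by the involution, and so is any product of such elements.
Along a reduced expression of `w`, the product is `q^{-l(w)/2}` times a combination of `T_x` with `x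
≤ w`. If its coefficients also meet the degree bounds and the coefficient at `w` is `1`, it is the
Kazhdan–Lusztig element (`isKLFamily_wordCoeff`). Uniqueness (`IsKLFamily.unique`) follows from
triangularity of the involution (`repr_TBar`) and the fact that a polynomial of small degree cannot
be skew symmetric (`eq_zero_of_bar_evalQ`).

For the present word the degree bounds survive the appending of each pair `s_{l+1} s_l`. Every `x`
in the support fixes all letters beyond `l + 1`, so multiplying by `1 + T_{s_{l+1}}` introduces no
factor `q`. Multiplying by `1 + T_{s_l}` introduces `q` only at old elements with descent `s_l`.
These differ from `w`, since `s_l` is an ascent of `w`, and the degree gained is paid for by the two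
new letters (`IsStrip.degree_mulStep`). The invariant `IsStrip` records what is needed to iterate.

If `a` and `b` are the coefficients at `e` and at `s_l`, then after the pair the coefficient at `e`
is `a + q b` and the one at `s_{l+1}` is `a`. This is the Fibonacci recursion, started at `a = 1`,
`b = 0` with the empty word. -/

namespace KazhdanLusztig

open Polynomial

noncomputable section

/-! ### The subword property of the Bruhat order -/

section Bruhat

variable {n : ℕ}

/-- Right ascents in terms of values. -/
theorem length_lt_mul_simple_iff {i : ℕ} (hi : 1 ≤ i ∧ i < n) (w : Equiv.Perm (Fin n)) :
    length w < length (w * simple n i) ↔ w ⟨i - 1, by omega⟩ < w ⟨i, hi.2⟩ := by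
  rw [length_mul_simple, ← length_inv w, length_lt_simple_mul_iff hi, inv_inv]

theorem length_mul_simple_le {i : ℕ} (hi : 1 ≤ i ∧ i < n) (w : Equiv.Perm (Fin n)) :
    length (w * simple n i) ≤ length w + 1 := by
  obtain ⟨L, hL, rfl, hl⟩ := exists_reducedExpression w
  have := length_le (L := L ++ [i]) (w := wordProd n L * simple n i)
    (by
      intro j hj
      rcases List.mem_append.1 hj with h | h
      · exact hL j h
      · rw [List.mem_singleton.1 h]; exact hi)
    (by rw [wordProd_append, wordProd_cons, wordProd_nil, mul_one])
  simpa [hl] using this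

theorem length_mul_simple_eq {i : ℕ} (hi : 1 ≤ i ∧ i < n) {w : Equiv.Perm (Fin n)}
    (h : length w < length (w * simple n i)) : length (w * simple n i) = length w + 1 :=
  le_antisymm (length_mul_simple_le hi w) h

theorem length_simple_mul_eq {i : ℕ} (hi : 1 ≤ i ∧ i < n) {w : Equiv.Perm (Fin n)}
    (h : length w < length (simple n i * w)) : length (simple n i * w) = length w + 1 := by
  have h1 := length_mul_simple i w⁻¹
  rw [inv_inv] at h1
  rw [← h1, ← length_inv w] at h ⊢
  exact length_mul_simple_eq hi h

/-- The strong exchange property: an inversion of a product is removed by deleting letters. -/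
theorem exists_sublist_swap_mul (L : List ℕ) (hL : IsExpression n L) {x y : Fin n} (hxy : x < y)
    (h : (wordProd n L)⁻¹ y < (wordProd n L)⁻¹ x) :
    ∃ L' : List ℕ, L'.Sublist L ∧ wordProd n L' = Equiv.swap x y * wordProd n L := by
  induction L generalizing x y with
  | nil => simp only [wordProd_nil, inv_one, Equiv.Perm.one_apply] at h; omega
  | cons i L ih =>
    by_cases hs : Equiv.swap x y = simple n i
    · refine ⟨L, List.sublist_cons_self i L, ?_⟩
      rw [hs, wordProd_cons, simple_mul_cancel]
    · rw [wordProd_cons, mul_inv_rev, simple_inv] at h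
      obtain ⟨L', h1, h2⟩ := ih (fun j hj => hL j (by simp [hj]))
        (simple_lt_simple (hL i (by simp)) hxy hs) h
      refine ⟨i :: L', h1.cons_cons i, ?_⟩
      rw [wordProd_cons, h2, wordProd_cons, Equiv.swap_apply_apply, simple_inv]
      simp only [mul_assoc, simple_mul_cancel]

/-- A step of the Bruhat graph: left multiplication by a transposition that creates an
inversion. -/
def BruhatStep (x y : Equiv.Perm (Fin n)) : Prop :=
  ∃ a b : Fin n, a < b ∧ x⁻¹ a < x⁻¹ b ∧ y = Equiv.swap a b * x

theorem BruhatStep.of_length_lt {i : ℕ} (hi : 1 ≤ i ∧ i < n) {w : Equiv.Perm (Fin n)}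
    (h : length w < length (simple n i * w)) : BruhatStep w (simple n i * w) :=
  ⟨⟨i - 1, by omega⟩, ⟨i, hi.2⟩, by rw [Fin.lt_def]; simp only []; omega,
    (length_lt_simple_mul_iff hi w).1 h, by rw [simple_eq hi]⟩

/-- Undoing the step removes an inversion of `w`, so strong exchange applies. The expression need
not be reduced, which lets the argument be repeated along a chain of steps. -/
theorem BruhatStep.exists_sublist {x w : Equiv.Perm (Fin n)} (h : BruhatStep x w) {L : List ℕ}
    (hL : IsExpression n L) (hw : wordProd n L = w) :
    ∃ L' : List ℕ, L'.Sublist L ∧ wordProd n L' = x := by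
  obtain ⟨a, b, hab, hx, rfl⟩ := h
  obtain ⟨L', h1, h2⟩ := exists_sublist_swap_mul L hL hab (by
    rw [hw, mul_inv_rev, Equiv.swap_inv, Equiv.Perm.mul_apply, Equiv.Perm.mul_apply,
      Equiv.swap_apply_left, Equiv.swap_apply_right]
    exact hx)
  exact ⟨L', h1, by rw [h2, hw, Equiv.swap_mul_self_mul]⟩

theorem exists_sublist_of_reflTransGen {x w : Equiv.Perm (Fin n)}
    (h : Relation.ReflTransGen BruhatStep x w) {L : List ℕ} (hL : IsExpression n L)
    (hw : wordProd n L = w) : ∃ L' : List ℕ, L'.Sublist L ∧ wordProd n L' = x := by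
  induction h using Relation.ReflTransGen.head_induction_on with
  | refl => exact ⟨L, List.Sublist.refl L, hw⟩
  | head hxy _ ih =>
    obtain ⟨L₁, h1, h2⟩ := ih
    obtain ⟨L₂, h3, h4⟩ := hxy.exists_sublist (fun j hj => hL j (h1.subset hj)) h2
    exact ⟨L₂, h3.trans h1, h4⟩

/-- The lifting property. Conjugation by `s` turns each step of the chain by a transposition `t ≠ s`
into a step between the translates by `s`; a step with `t = s` already leads from `x` to `s x`. -/
theorem reflTransGen_simple_mul {i : ℕ} (hi : 1 ≤ i ∧ i < n) {x w : Equiv.Perm (Fin n)}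
    (h : Relation.ReflTransGen BruhatStep x w) :
    Relation.ReflTransGen BruhatStep (simple n i * x) w ∨
      Relation.ReflTransGen BruhatStep (simple n i * x) (simple n i * w) := by
  induction h using Relation.ReflTransGen.head_induction_on with
  | refl => exact Or.inr .refl
  | @head x y hxy hyw ih =>
    obtain ⟨a, b, hab, hx, rfl⟩ := hxy
    by_cases hs : Equiv.swap a b = simple n i
    · rw [hs] at hyw
      exact Or.inl hyw
    · have hstep : BruhatStep (simple n i * x) (simple n i * (Equiv.swap a b * x)) := by
        refine ⟨simple n i a, simple n i b, simple_lt_simple hi hab hs, ?_, ?_⟩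
        · rw [← Equiv.Perm.mul_apply, ← Equiv.Perm.mul_apply, mul_inv_rev,
            inv_mul_cancel_right]
          exact hx
        · rw [Equiv.swap_apply_apply, simple_inv]
          simp only [mul_assoc, simple_mul_cancel]
      exact ih.imp (.head hstep) (.head hstep)

theorem IsReducedExpression.tail {i : ℕ} {L : List ℕ} {w : Equiv.Perm (Fin n)}
    (h : IsReducedExpression w (i :: L)) :
    (1 ≤ i ∧ i < n) ∧ IsReducedExpression (wordProd n L) L ∧
      length (wordProd n L) < length (simple n i * wordProd n L) := by
  obtain ⟨h1, rfl, h3⟩ := h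
  have hi := h1 i (by simp)
  have hL : IsExpression n L := fun j hj => h1 j (by simp [hj])
  have h4 := length_le hL rfl
  rw [wordProd_cons, List.length_cons] at h3
  have h5 : length (simple n i * wordProd n L) ≤ length (wordProd n L) + 1 := by
    rw [← length_inv (simple n i * _), ← length_inv (wordProd n L), mul_inv_rev, simple_inv]
    exact length_mul_simple_le hi _
  exact ⟨hi, ⟨hL, rfl, by omega⟩, by omega⟩

/-- Omitting the first letter of a reduced expression costs one step upwards; keeping it is handled
by the lifting property. -/
theorem reflTransGen_of_sublist {L : List ℕ} {w : Equiv.Perm (Fin n)}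
    (hL : IsReducedExpression w L) {L' : List ℕ} (h : L'.Sublist L) :
    Relation.ReflTransGen BruhatStep (wordProd n L') w := by
  induction h generalizing w with
  | slnil => rw [← hL.2.1]
  | @cons L' L i _ ih =>
    obtain ⟨hi, hL', hlt⟩ := hL.tail
    rw [← hL.2.1, wordProd_cons]
    exact (ih hL').tail (.of_length_lt hi hlt)
  | @cons_cons L' L i _ ih =>
    obtain ⟨hi, hL', hlt⟩ := hL.tail
    rw [← hL.2.1, wordProd_cons, wordProd_cons]
    exact (reflTransGen_simple_mul hi (ih hL')).elim (·.tail (.of_length_lt hi hlt)) id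

/-- The subword property: one reduced expression suffices to test the Bruhat order. -/
theorem bruhatLE_of_sublist {L : List ℕ} {w : Equiv.Perm (Fin n)}
    (hL : IsReducedExpression w L) {L' : List ℕ} (h : L'.Sublist L) :
    BruhatLE (wordProd n L') w := fun _ hM =>
  exists_sublist_of_reflTransGen (reflTransGen_of_sublist hL h) hM.1 hM.2.1

theorem BruhatLE.length_lt {x w : Equiv.Perm (Fin n)} (h : BruhatLE x w) (hne : x ≠ w) :
    length x < length w := by
  obtain ⟨L, hL⟩ := exists_reducedExpression w
  obtain ⟨L', h1, h2⟩ := h L hL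
  have h3 := length_le (fun j hj => hL.1 j (h1.subset hj)) h2
  rcases h1.length_le.lt_or_eq with h4 | h4
  · have := hL.2.2
    omega
  · exact absurd (by rw [← h2, h1.eq_of_length h4, hL.2.1]) hne

end Bruhat

/-! ### Multiplication in the Hecke algebra -/

section HeckeMul

variable {n : ℕ} {R : Type*} [CommRing R] {q : R}

/-- Elements of the Hecke algebra commute with the right operators. This gives the right-handed
multiplication rules, although the algebra is built from left operators. -/
theorem evalOne_mul_T_simple {i : ℕ} (hi : 1 ≤ i ∧ i < n) (h : Hecke n q) :
    evalOne n q (h * T n q (simple n i)) = rightOp n q i (evalOne n q h) := by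
  have h1 : vec R (simple n i) = rightOp n q i (vec R 1) := by
    rw [rightOp_single, one_mul, if_pos]
    rw [length_one, length_simple hi]
    exact one_pos
  rw [evalOne_mul, evalOne_T, h1, evalOne_apply]
  exact LinearMap.congr_fun (commute_rightOp h.2 hi) (vec R 1)

theorem T_mul_simple {i : ℕ} (hi : 1 ≤ i ∧ i < n) {w : Equiv.Perm (Fin n)}
    (h : length w < length (w * simple n i)) :
    T n q w * T n q (simple n i) = T n q (w * simple n i) := by
  apply evalOne_injective
  rw [evalOne_mul_T_simple hi, evalOne_T, evalOne_T, rightOp_single, if_pos h]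

theorem length_mul_simple_ne {i : ℕ} (hi : 1 ≤ i ∧ i < n) (w : Equiv.Perm (Fin n)) :
    length w < length (w * simple n i) ∨ length (w * simple n i) < length w := by
  by_cases h : length w < length (w * simple n i)
  · exact Or.inl h
  · right
    rw [length_lt_mul_simple_iff hi] at h
    have h2 := (length_lt_mul_simple_iff hi (w * simple n i)).2 (by
      rw [Equiv.Perm.mul_apply, Equiv.Perm.mul_apply, simple_eq hi, Equiv.swap_apply_left,
        Equiv.swap_apply_right]
      refine lt_of_le_of_ne (not_lt.1 h) fun h' => ?_
      have := congrArg Fin.val (w.injective h')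
      simp only [] at this
      omega)
    rwa [mul_simple_cancel] at h2

theorem length_simple_mul_ne {i : ℕ} (hi : 1 ≤ i ∧ i < n) (w : Equiv.Perm (Fin n)) :
    length w < length (simple n i * w) ∨ length (simple n i * w) < length w := by
  have := length_mul_simple_ne hi w⁻¹
  rwa [length_mul_simple, inv_inv, length_inv] at this

theorem T_simple_mul_of_lt {i : ℕ} (hi : 1 ≤ i ∧ i < n) {w : Equiv.Perm (Fin n)}
    (h : ¬ length w < length (simple n i * w)) :
    T n q (simple n i) * T n q w = (q - 1) • T n q w + q • T n q (simple n i * w) := by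
  apply evalOne_injective
  rw [map_add, map_smul, map_smul, evalOne_T, evalOne_T, T_simple hi, evalOne_mul, evalOne_T]
  exact (leftOp_single q i w).trans (if_neg h)

theorem T_mul_simple_of_lt {i : ℕ} (hi : 1 ≤ i ∧ i < n) {w : Equiv.Perm (Fin n)}
    (h : ¬ length w < length (w * simple n i)) :
    T n q w * T n q (simple n i) = (q - 1) • T n q w + q • T n q (w * simple n i) := by
  apply evalOne_injective
  rw [map_add, map_smul, map_smul, evalOne_T, evalOne_T, evalOne_mul_T_simple hi, evalOne_T,
    rightOp_single, if_neg h]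

theorem T_mul_one_add {i : ℕ} (hi : 1 ≤ i ∧ i < n) (w : Equiv.Perm (Fin n)) :
    T n q w * (1 + T n q (simple n i)) =
      (if length w < length (w * simple n i) then 1 else q) •
        (T n q w + T n q (w * simple n i)) := by
  split_ifs with h
  · rw [mul_add, mul_one, T_mul_simple hi h, one_smul]
  · rw [mul_add, mul_one, T_mul_simple_of_lt hi h]
    module

/-- The transpose of left multiplication by `T_s`: both sides are linear in `h`, so it suffices to
compare them on the basis. -/
theorem repr_T_simple_mul {i : ℕ} (hi : 1 ≤ i ∧ i < n) (h : Hecke n q)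
    (x : Equiv.Perm (Fin n)) :
    (T n q).repr (T n q (simple n i) * h) x =
      if length x < length (simple n i * x) then q * (T n q).repr h (simple n i * x)
      else (q - 1) * (T n q).repr h x + (T n q).repr h (simple n i * x) := by
  have key : (T n q).coord x ∘ₗ LinearMap.mulLeft R (T n q (simple n i)) =
      if length x < length (simple n i * x) then q • (T n q).coord (simple n i * x)
      else (q - 1) • (T n q).coord x + (T n q).coord (simple n i * x) := by
    refine (T n q).ext fun y => ?_
    have h0 := length_simple_mul_ne hi x
    have h0' := length_simple_mul_ne hi y
    have e1 : simple n i * y = x ↔ y = simple n i * x := by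
      constructor <;> rintro rfl <;> rw [simple_mul_cancel]
    rw [LinearMap.comp_apply, LinearMap.mulLeft_apply]
    by_cases hy : length y < length (simple n i * y)
    · rw [T_simple_mul hi hy]
      by_cases hyx : y = simple n i * x
      · subst hyx
        rw [simple_mul_cancel] at hy h0' ⊢
        rw [if_neg (by omega)]
        have : simple n i * x ≠ x := fun h => by rw [h] at hy; omega
        simp [this]
      · split_ifs with hx
        · simp [e1, hyx]
        · have : y ≠ x := by rintro rfl; exact hx hy
          simp [e1, hyx, this]
    · rw [T_simple_mul_of_lt hi hy]
      by_cases hyx : y = simple n i * x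
      · subst hyx
        rw [simple_mul_cancel] at hy h0' ⊢
        rw [if_pos (by omega)]
        have : simple n i * x ≠ x := fun h => by rw [h] at h0; omega
        simp [this]
      · split_ifs with hx
        · have : y ≠ x := by rintro rfl; exact hy hx
          simp [e1, hyx, this]
        · simp only [map_add, map_smul, Module.Basis.repr_self, LinearMap.add_apply,
            LinearMap.smul_apply, Module.Basis.coord_apply, Finsupp.single_apply, e1, hyx,
            if_false, smul_zero]
  have := LinearMap.congr_fun key h
  rw [LinearMap.comp_apply, LinearMap.mulLeft_apply, Module.Basis.coord_apply] at this
  rw [this]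
  split_ifs <;> simp

end HeckeMul

/-! ### The involution -/

section Iota

variable {n : ℕ}

theorem inverse_mul_of_isUnit {M : Type*} [MonoidWithZero M] {a b : M} (ha : IsUnit a)
    (hb : IsUnit b) : Ring.inverse (a * b) = Ring.inverse b * Ring.inverse a := by
  obtain ⟨u, rfl⟩ := ha
  obtain ⟨v, rfl⟩ := hb
  rw [← Units.val_mul, Ring.inverse_unit, Ring.inverse_unit, Ring.inverse_unit, mul_inv_rev,
    Units.val_mul]

/-- The image `(T_{w⁻¹})⁻¹` of `T_w` under the involution. -/
def TBar (w : Equiv.Perm (Fin n)) : Hecke n q := Ring.inverse (T n q w⁻¹)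

theorem isUnit_T_q (w : Equiv.Perm (Fin n)) : IsUnit (T n q w) :=
  isUnit_T q_ne_zero.isUnit w

theorem TBar_one : TBar (1 : Equiv.Perm (Fin n)) = 1 := by
  rw [TBar, inv_one, T_one, Ring.inverse_one]

theorem TBar_simple {i : ℕ} (hi : 1 ≤ i ∧ i < n) :
    TBar (simple n i) = q⁻¹ • (T n q (simple n i) - (q - 1) • 1) := by
  rw [TBar, simple_inv]
  have h := T_simple_sq (q := q) hi
  rw [T_one] at h
  have h1 : T n q (simple n i) * (q⁻¹ • (T n q (simple n i) - (q - 1) • 1)) = 1 := by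
    rw [mul_smul_comm, mul_sub, mul_smul_comm, mul_one, ← pow_two, h, add_sub_cancel_left,
      smul_smul, inv_mul_cancel₀ q_ne_zero, one_smul]
  calc Ring.inverse (T n q (simple n i)) = Ring.inverse (T n q (simple n i)) * 1 := (mul_one _).symm
    _ = Ring.inverse (T n q (simple n i)) *
        (T n q (simple n i) * (q⁻¹ • (T n q (simple n i) - (q - 1) • 1))) := by rw [h1]
    _ = _ := by rw [Ring.inverse_mul_cancel_left _ _ (isUnit_T_q _)]

/-- The quadratic relation with `q` replaced by `q⁻¹ = bar q`; it makes the involution respect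
multiplication at descents. -/
theorem TBar_simple_sq {i : ℕ} (hi : 1 ≤ i ∧ i < n) :
    TBar (simple n i) * TBar (simple n i) =
      (q⁻¹ - 1) • TBar (simple n i) + q⁻¹ • (1 : Hecke n q) := by
  have h := T_simple_sq (q := q) hi
  rw [T_one] at h
  have h2 : TBar (simple n i) * T n q (simple n i) = 1 := by
    rw [TBar, simple_inv]
    exact Ring.inverse_mul_cancel _ (isUnit_T_q _)
  nth_rewrite 2 [TBar_simple hi]
  rw [mul_smul_comm, mul_sub, h2, mul_smul_comm, mul_one, smul_sub, smul_smul, mul_sub,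
    inv_mul_cancel₀ q_ne_zero, mul_one, sub_smul, sub_smul]
  abel

theorem TBar_simple_mul {i : ℕ} (hi : 1 ≤ i ∧ i < n) {w : Equiv.Perm (Fin n)}
    (h : length w < length (simple n i * w)) :
    TBar (simple n i * w) = TBar (simple n i) * TBar w := by
  rw [TBar, TBar, TBar, mul_inv_rev, simple_inv, ← T_mul_simple hi,
    inverse_mul_of_isUnit (isUnit_T_q _) (isUnit_T_q _)]
  rwa [length_mul_simple, inv_inv, length_inv]

theorem TBar_mul_simple {i : ℕ} (hi : 1 ≤ i ∧ i < n) {w : Equiv.Perm (Fin n)}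
    (h : length w < length (w * simple n i)) :
    TBar (w * simple n i) = TBar w * TBar (simple n i) := by
  rw [TBar, TBar, TBar, mul_inv_rev, simple_inv, ← T_simple_mul hi,
    inverse_mul_of_isUnit (isUnit_T_q _) (isUnit_T_q _)]
  rwa [length_mul_simple, ← length_inv w] at h

/-- The involution is triangular with respect to the length. -/
theorem repr_TBar (w x : Equiv.Perm (Fin n)) (h : length w ≤ length x) :
    (T n q).repr (TBar w) x = if x = w then q⁻¹ ^ length w else 0 := by
  induction w using induction_left generalizing x with
  | h1 => rw [TBar_one, ← T_one, Module.Basis.repr_self, Finsupp.single_apply, length_one, pow_zero]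
          simp only [eq_comm]
  | h i v hi hv ih =>
    have hl := length_simple_mul_eq hi hv
    have hx : (T n q).repr (TBar v) x = 0 := by
      rw [ih x (by omega), if_neg]
      rintro rfl
      omega
    have e1 : simple n i * x = v ↔ x = simple n i * v := by
      constructor <;> rintro rfl <;> rw [simple_mul_cancel]
    rw [TBar_simple_mul hi hv, TBar_simple hi, smul_mul_assoc, sub_mul, smul_mul_assoc, one_mul,
      map_smul, map_sub, map_smul, Finsupp.smul_apply, Finsupp.sub_apply, Finsupp.smul_apply, hx,
      smul_zero, sub_zero, repr_T_simple_mul hi, hx]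
    -- By induction only the coefficient of `TBar v` at `s x` can survive, and by length it vanishes
    -- unless `s x = v`.
    split_ifs with h1 h2 h2
    · subst h2
      rw [simple_mul_cancel] at h1
      omega
    · rw [ih _ (by omega), if_neg (mt e1.1 h2), mul_zero, smul_zero]
    · rw [ih _ (by rw [e1.2 h2]), if_pos (e1.2 h2), hl]
      simp only [smul_eq_mul]
      ring
    · have h3 := (length_simple_mul_ne hi x).resolve_left h1
      have h4 := length_simple_mul_eq hi (w := simple n i * x) (by rwa [simple_mul_cancel])
      rw [simple_mul_cancel] at h4
      rw [ih _ (by omega), if_neg (mt e1.1 h2), mul_zero, add_zero, smul_zero]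

theorem iota_eq_sum (h : Hecke n q) :
    iota h = ∑ w : Equiv.Perm (Fin n), bar ((T n q).repr h w) • TBar w := rfl

theorem iota_add (g h : Hecke n q) : iota (g + h) = iota g + iota h := by
  simp only [iota_eq_sum, map_add, Finsupp.add_apply, add_smul, Finset.sum_add_distrib]

theorem iota_smul (a : A) (h : Hecke n q) : iota (a • h) = bar a • iota h := by
  simp only [iota_eq_sum, map_smul, Finsupp.smul_apply, smul_eq_mul, map_mul, mul_smul,
    Finset.smul_sum]

/-- The involution as a semilinear map. -/
def iotaHom (n : ℕ) : Hecke n q →ₛₗ[bar] Hecke n q where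
  toFun := iota
  map_add' := iota_add
  map_smul' := iota_smul

theorem iotaHom_apply (h : Hecke n q) : iotaHom n h = iota h := rfl

theorem iota_T (w : Equiv.Perm (Fin n)) : iota (T n q w) = TBar w := by
  rw [iota_eq_sum, Finset.sum_eq_single w]
  · simp
  · intro v _ hv
    simp [hv.symm]
  · simp

theorem bar_q : bar q = q⁻¹ := by rw [q, map_pow, bar_qHalf, inv_pow]

/-- Multiplicativity is needed only for a right factor `T_s`. On a basis element it is clear at an
ascent, and at a descent it reduces to the quadratic relation for `TBar`. -/
theorem iota_mul_T_simple {i : ℕ} (hi : 1 ≤ i ∧ i < n) (h : Hecke n q) :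
    iota (h * T n q (simple n i)) = iota h * TBar (simple n i) := by
  rw [← (T n q).sum_repr h, Finset.sum_mul, ← iotaHom_apply, ← iotaHom_apply, map_sum, map_sum,
    Finset.sum_mul]
  refine Finset.sum_congr rfl fun w _ => ?_
  rw [smul_mul_assoc, map_smulₛₗ, map_smulₛₗ, smul_mul_assoc]
  congr 1
  rw [iotaHom_apply, iotaHom_apply, iota_T]
  by_cases hw : length w < length (w * simple n i)
  · rw [T_mul_simple hi hw, iota_T, TBar_mul_simple hi hw]
  · have h1 := (length_mul_simple_ne hi w).resolve_left hw
    have h2 := TBar_mul_simple hi (w := w * simple n i) (by rwa [mul_simple_cancel])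
    rw [mul_simple_cancel] at h2
    rw [T_mul_simple_of_lt hi hw, iota_add, iota_smul, iota_smul, iota_T, iota_T, map_sub, bar_q,
      map_one, h2, mul_assoc, TBar_simple_sq hi, mul_add, mul_smul_comm, mul_smul_comm, mul_one]

/-- Because `1 + T_s⁻¹ = q⁻¹ (1 + T_s)`. -/
theorem iota_mul_one_add {i : ℕ} (hi : 1 ≤ i ∧ i < n) (h : Hecke n q) :
    iota (h * (1 + T n q (simple n i))) = q⁻¹ • (iota h * (1 + T n q (simple n i))) := by
  rw [mul_add, mul_one, iota_add, iota_mul_T_simple hi, TBar_simple hi, mul_smul_comm, mul_sub,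
    mul_smul_comm, mul_one, mul_add, mul_one, smul_sub, smul_smul, mul_sub,
    inv_mul_cancel₀ q_ne_zero, mul_one, sub_smul, one_smul, smul_add]
  abel

end Iota

/-! ### Uniqueness of the Kazhdan–Lusztig family -/

section Unique

variable {n : ℕ}

/-- The evaluation of a polynomial at `q ∈ ℚ(q^{1/2})`. -/
def evalQ : ℚ[X] →+* A := Polynomial.eval₂RingHom RatFunc.C q

theorem evalQ_apply (p : ℚ[X]) : evalQ p = p.eval₂ RatFunc.C q := rfl

theorem evalQ_X : evalQ X = q := by rw [evalQ_apply, eval₂_X]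

theorem eval₂_X_sq_injective (K : Type) [Field K] :
    Function.Injective (Polynomial.eval₂RingHom (RatFunc.C (K := K)) (RatFunc.X ^ 2)) := by
  have h : Transcendental K ((RatFunc.X : RatFunc K) ^ 2) := RatFunc.transcendental_X.pow two_pos
  exact transcendental_iff_injective.1 h

theorem evalQ_injective : Function.Injective evalQ := eval₂_X_sq_injective ℚ

theorem bar_evalQ (p : ℚ[X]) : q ^ p.natDegree * bar (evalQ p) = evalQ p.reverse := by
  -- Ring homomorphisms out of `ℚ` are unique, so the involution fixes the constants.
  have h1 : bar.comp RatFunc.C = (RatFunc.C : ℚ →+* A) := Subsingleton.elim _ _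
  let _ : Invertible q⁻¹ := ⟨q, mul_inv_cancel₀ q_ne_zero, inv_mul_cancel₀ q_ne_zero⟩
  have h2 := eval₂_reverse_mul_pow (RatFunc.C : ℚ →+* A) q⁻¹ p
  rw [show ⅟(q⁻¹) = q from rfl] at h2
  rw [evalQ_apply, evalQ_apply, hom_eval₂, h1, bar_q, ← h2, mul_left_comm, ← mul_pow,
    mul_inv_cancel₀ q_ne_zero, one_pow, mul_one]

/-- A polynomial of small degree cannot satisfy the skew symmetry `q^m \bar p = p`. -/
theorem eq_zero_of_bar_evalQ {p : ℚ[X]} {m : ℕ} (hm : 2 * p.natDegree < m)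
    (h : q ^ m * bar (evalQ p) = evalQ p) : p = 0 := by
  obtain ⟨d, rfl⟩ := Nat.exists_eq_add_of_lt (show p.natDegree < m by omega)
  have h1 : X ^ (d + 1) * p.reverse = p := by
    apply evalQ_injective
    rw [map_mul, map_pow, evalQ_X, ← bar_evalQ, ← mul_assoc, ← pow_add,
      show d + 1 + p.natDegree = p.natDegree + d + 1 by omega]
    exact h
  by_contra hp
  -- Here `d + 1 = m - deg p > deg p`, so divisibility by `X ^ (d + 1)` kills the leading
  -- coefficient.
  have h2 : p.coeff p.natDegree = 0 := by
    conv_lhs => rw [← h1]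
    rw [coeff_X_pow_mul', if_neg (by rw [h1]; omega)]
  exact hp (leadingCoeff_eq_zero.1 h2)

/-- The element `∑_x c_x(q) T_x` of the Hecke algebra. -/
def toHecke (c : Equiv.Perm (Fin n) → ℚ[X]) : Hecke n q :=
  ∑ x : Equiv.Perm (Fin n), evalQ (c x) • T n q x

theorem repr_toHecke (c : Equiv.Perm (Fin n) → ℚ[X]) (x : Equiv.Perm (Fin n)) :
    (T n q).repr (toHecke c) x = evalQ (c x) := by
  rw [toHecke, Module.Basis.repr_sum_self]

theorem klElement_eq {w : Equiv.Perm (Fin n)} {P : Equiv.Perm (Fin n) → ℚ[X]}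
    (h : ∀ x, ¬ BruhatLE x w → P x = 0) :
    klElement w P = (qHalf ^ length w)⁻¹ • toHecke P := by
  classical
  rw [klElement, toHecke]
  congr 1
  refine Finset.sum_subset (Finset.subset_univ _) fun x _ hx => ?_
  rw [h x (by simpa using hx), eval₂_zero, zero_smul]

/-- The involution inverts `q^{-r/2}`, so clearing the normalization leaves `q ^ r` and no half
powers. -/
theorem iota_normalized_eq_iff (r : ℕ) (h : Hecke n q) :
    iota ((qHalf ^ r)⁻¹ • h) = (qHalf ^ r)⁻¹ • h ↔ q ^ r • iota h = h := by
  have h0 : qHalf ^ r ≠ 0 := pow_ne_zero _ qHalf_ne_zero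
  rw [iota_smul, map_inv₀, map_pow, bar_qHalf, inv_pow, inv_inv, eq_inv_smul_iff₀ h0, smul_smul,
    ← mul_pow, ← pow_two]
  rfl

theorem IsKLFamily.iota_toHecke {w : Equiv.Perm (Fin n)} {P : Equiv.Perm (Fin n) → ℚ[X]}
    (h : IsKLFamily w P) : q ^ length w • iota (toHecke P) = toHecke P := by
  have := h.iota_eq
  rwa [klElement_eq h.eq_zero, iota_normalized_eq_iff] at this

theorem IsKLFamily.unique {w : Equiv.Perm (Fin n)} {P Q : Equiv.Perm (Fin n) → ℚ[X]}
    (hP : IsKLFamily w P) (hQ : IsKLFamily w Q) : P = Q := by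
  classical
  by_contra hne
  have hs : (Finset.univ.filter fun x => P x ≠ Q x).Nonempty := by
    obtain ⟨x, hx⟩ := Function.ne_iff.1 hne
    exact ⟨x, by simpa using hx⟩
  -- With `x` of maximal length among the places of disagreement, triangularity leaves only the term
  -- `y = x` in the coefficient of `T_x`. The difference there satisfies the skew symmetry with `m =
  -- l(w) - l(x)`.
  obtain ⟨x, hx, hmax⟩ := Finset.exists_max_image _ length hs
  simp only [Finset.mem_filter, Finset.mem_univ, true_and] at hx hmax
  have hxw : x ≠ w := by
    rintro rfl
    exact hx (hP.self.trans hQ.self.symm)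
  have hle : BruhatLE x w := by
    by_contra h
    exact hx ((hP.eq_zero x h).trans (hQ.eq_zero x h).symm)
  have hcoeff : ∀ R : Equiv.Perm (Fin n) → ℚ[X], IsKLFamily w R →
      q ^ length w * ∑ y, bar (evalQ (R y)) * (T n q).repr (TBar y) x = evalQ (R x) := by
    intro R hR
    have := congrArg (fun h => (T n q).repr h x) hR.iota_toHecke
    simpa only [map_smul, Finsupp.smul_apply, iota_eq_sum, map_sum, Finsupp.finsetSum_apply,
      repr_toHecke, smul_eq_mul] using this
  have hdiff : q ^ length w * ∑ y, bar (evalQ (P y - Q y)) * (T n q).repr (TBar y) x =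
      evalQ (P x - Q x) := by
    simp only [map_sub, sub_mul, Finset.sum_sub_distrib, mul_sub]
    rw [hcoeff P hP, hcoeff Q hQ]
  rw [Finset.sum_eq_single x] at hdiff
  · rw [repr_TBar x x le_rfl, if_pos rfl] at hdiff
    refine hx (sub_eq_zero.1 (eq_zero_of_bar_evalQ (m := length w - length x) ?_ ?_))
    · have h1 := hP.degree_le x hle hxw
      have h2 := hQ.degree_le x hle hxw
      have h3 := natDegree_sub_le (P x) (Q x)
      rcases max_choice (P x).natDegree (Q x).natDegree with h | h <;> omega
    · have := (hle.length_lt hxw).le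
      rw [pow_sub₀ _ q_ne_zero this, ← inv_pow, mul_assoc, mul_comm (q⁻¹ ^ _)]
      exact hdiff
  · intro y _ hy
    by_cases h : P y = Q y
    · rw [h, sub_self, map_zero, map_zero, zero_mul]
    · rw [repr_TBar y x (hmax y h), if_neg hy.symm, mul_zero]
  · simp

theorem klPoly_eq {w : Equiv.Perm (Fin n)} {P : Equiv.Perm (Fin n) → ℚ[X]}
    (hP : IsKLFamily w P) (x : Equiv.Perm (Fin n)) : klPoly x w = P x := by
  have h : ∃! P : Equiv.Perm (Fin n) → ℚ[X], IsKLFamily w P :=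
    ⟨P, hP, fun _ hQ => hQ.unique hP⟩
  rw [klPoly, dif_pos h, h.choose_spec.1.unique hP]

end Unique

/-! ### Products of the elements `1 + T_s` -/

section Product

variable {n : ℕ}

/-- The coefficient in `T_y (1 + T_s) = a (T_y + T_{ys})`, `s = s_i`. -/
def stepWeight (i : ℕ) (y : Equiv.Perm (Fin n)) : ℚ[X] :=
  if length y < length (y * simple n i) then 1 else X

/-- The effect of the right multiplication by `1 + T_s`, `s = s_i`, on coefficients. -/
def mulStep (i : ℕ) (c : Equiv.Perm (Fin n) → ℚ[X]) (y : Equiv.Perm (Fin n)) : ℚ[X] :=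
  stepWeight i y * c y + stepWeight i (y * simple n i) * c (y * simple n i)

/-- The coefficients of the product of the elements `1 + T_s` along an expression. -/
def wordCoeff (n : ℕ) (L : List ℕ) : Equiv.Perm (Fin n) → ℚ[X] :=
  L.foldl (fun c i => mulStep i c) (Pi.single 1 1)

theorem wordCoeff_nil : wordCoeff n [] = Pi.single 1 1 := rfl

theorem wordCoeff_concat (L : List ℕ) (i : ℕ) :
    wordCoeff n (L ++ [i]) = mulStep i (wordCoeff n L) := by
  simp [wordCoeff]

theorem toHecke_mulStep {i : ℕ} (hi : 1 ≤ i ∧ i < n) (c : Equiv.Perm (Fin n) → ℚ[X]) :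
    toHecke (mulStep i c) = toHecke c * (1 + T n q (simple n i)) := by
  have h1 : ∀ y : Equiv.Perm (Fin n), evalQ (stepWeight i y) =
      if length y < length (y * simple n i) then 1 else q := by
    intro y
    rw [stepWeight]
    split_ifs
    · exact map_one _
    · exact evalQ_X
  simp only [toHecke, Finset.sum_mul, smul_mul_assoc, T_mul_one_add hi, ← h1, smul_add,
    Finset.sum_add_distrib, smul_smul]
  simp only [mulStep, map_add, map_mul, add_smul, Finset.sum_add_distrib]
  congr 1
  · exact Finset.sum_congr rfl fun y _ => by rw [mul_comm]
  · refine Fintype.sum_equiv (Equiv.mulRight (simple n i)) _ _ fun y => ?_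
    rw [Equiv.coe_mulRight, mul_simple_cancel, mul_comm]

/-- Each factor `1 + T_s` contributes `q⁻¹` under the involution, so the power of `q` counts
letters. -/
theorem iota_toHecke_wordCoeff {L : List ℕ} (hL : IsExpression n L) :
    q ^ L.length • iota (toHecke (wordCoeff n L)) = toHecke (wordCoeff n L) := by
  induction L using List.reverseRecOn with
  | nil =>
    have : toHecke (wordCoeff n []) = T n q 1 := by
      rw [wordCoeff_nil, toHecke, Finset.sum_eq_single 1]
      · simp
      · intro y _ hy
        simp [hy]
      · simp
    rw [this, iota_T, TBar_one, T_one, List.length_nil, pow_zero, one_smul]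
  | append_singleton L i ih =>
    have hi := hL i (by simp)
    rw [wordCoeff_concat, toHecke_mulStep hi, iota_mul_one_add hi, List.length_append,
      List.length_singleton, smul_smul, pow_succ, mul_assoc, mul_inv_cancel₀ q_ne_zero, mul_one,
      ← smul_mul_assoc, ih fun j hj => hL j (by simp [hj])]

/-- A nonzero coefficient at `x` comes from `x` or from `x s` one letter earlier: the last letter is
omitted or kept. -/
theorem exists_sublist_of_wordCoeff_ne_zero {L : List ℕ} {x : Equiv.Perm (Fin n)}
    (h : wordCoeff n L x ≠ 0) : ∃ L' : List ℕ, L'.Sublist L ∧ wordProd n L' = x := by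
  induction L using List.reverseRecOn generalizing x with
  | nil =>
    rw [wordCoeff_nil, Pi.single_apply] at h
    exact ⟨[], List.Sublist.refl _, by by_contra h'; exact h (if_neg (Ne.symm h'))⟩
  | append_singleton L i ih =>
    rw [wordCoeff_concat, mulStep] at h
    by_cases hx : wordCoeff n L x = 0
    · by_cases hx' : wordCoeff n L (x * simple n i) = 0
      · rw [hx, hx', mul_zero, mul_zero, add_zero] at h
        exact absurd rfl h
      · obtain ⟨L', h1, h2⟩ := ih hx'
        refine ⟨L' ++ [i], h1.append (List.Sublist.refl _), ?_⟩
        rw [wordProd_append, h2, wordProd_cons, wordProd_nil, mul_one, mul_simple_cancel]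
    · obtain ⟨L', h1, h2⟩ := ih hx
      exact ⟨L', h1.trans (List.sublist_append_left _ _), h2⟩

/-- If the product of the elements `1 + T_s` along a reduced expression satisfies the degree
bounds, then its coefficients are the Kazhdan–Lusztig polynomials. -/
theorem isKLFamily_wordCoeff {w : Equiv.Perm (Fin n)} {L : List ℕ}
    (hL : IsReducedExpression w L) (hself : wordCoeff n L w = 1)
    (hdeg : ∀ x j, x ≠ w → (wordCoeff n L x).coeff j ≠ 0 → 2 * j + length x + 1 ≤ length w) :
    IsKLFamily w (wordCoeff n L) := by
  have hzero : ∀ x, ¬ BruhatLE x w → wordCoeff n L x = 0 := by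
    intro x hx
    by_contra h
    obtain ⟨L', h1, rfl⟩ := exists_sublist_of_wordCoeff_ne_zero h
    exact hx (bruhatLE_of_sublist hL h1)
  refine ⟨hself, fun x hx hne => ?_, hzero, ?_⟩
  -- The zero polynomial has `natDegree` equal to `0`, so in that case the bound amounts to `l(x) <
  -- l(w)`.
  · by_cases h : wordCoeff n L x = 0
    · rw [h, natDegree_zero]
      have := hx.length_lt hne
      omega
    · exact hdeg x _ hne (leadingCoeff_ne_zero.2 h)
  · rw [klElement_eq hzero, iota_normalized_eq_iff, ← hL.2.2]
    exact iota_toHecke_wordCoeff hL.1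

end Product

/-! ### Appending the pair `s_{l+1} s_l` -/

section Strip

variable {n l : ℕ}

/-- The state of the product of the elements `1 + T_s` before the pair `s_{l+1} s_l` is appended:
only the letters `1, …, l + 1` are moved, `s_l` is a right ascent of `w`, and the coefficients `c`
satisfy the degree bounds of the Kazhdan–Lusztig family of `w`. -/
structure IsStrip (l : ℕ) (w : Equiv.Perm (Fin n)) (c : Equiv.Perm (Fin n) → ℚ[X]) : Prop where
  fix : ∀ x, c x ≠ 0 → ∀ p : Fin n, l < p → x p = p
  asc : length w < length (w * simple n l)
  self : c w = 1
  degree : ∀ x j, x ≠ w → (c x).coeff j ≠ 0 → 2 * j + length x + 1 ≤ length w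

theorem simple_apply_left {i : ℕ} (hi : 1 ≤ i ∧ i < n) :
    simple n i ⟨i - 1, by omega⟩ = ⟨i, hi.2⟩ := by
  rw [simple_eq hi, Equiv.swap_apply_left]

theorem simple_apply_right {i : ℕ} (hi : 1 ≤ i ∧ i < n) :
    simple n i ⟨i, hi.2⟩ = ⟨i - 1, by omega⟩ := by
  rw [simple_eq hi, Equiv.swap_apply_right]

theorem simple_apply_of_ne {i : ℕ} (p : Fin n) (h1 : (p : ℕ) ≠ i - 1) (h2 : (p : ℕ) ≠ i) :
    simple n i p = p := by
  unfold simple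
  split_ifs with h
  · exact Equiv.swap_apply_of_ne_of_ne (fun h => h1 (congrArg Fin.val h))
      (fun h => h2 (congrArg Fin.val h))
  · rfl

theorem apply_le_of_fix {x : Equiv.Perm (Fin n)} (hx : ∀ p : Fin n, l < p → x p = p)
    {p : Fin n} (hp : (p : ℕ) ≤ l) : ((x p : Fin n) : ℕ) ≤ l := by
  by_contra! h
  have := x.injective (hx _ h)
  rw [this] at h
  omega

theorem lt_mul_simple_of_fix (hl : l + 1 < n) {x : Equiv.Perm (Fin n)}
    (hx : ∀ p : Fin n, l < p → x p = p) : length x < length (x * simple n (l + 1)) := by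
  rw [length_lt_mul_simple_iff (i := l + 1) ⟨by omega, hl⟩, hx ⟨l + 1, hl⟩ (Nat.lt_succ_self l),
    Fin.lt_def]
  exact Nat.lt_succ_of_le (apply_le_of_fix hx le_rfl)

/-- Counting positions from `0`, `x s_{l+1}` has the value `l + 1` at position `l`, and the value at
position `l - 1` is smaller. -/
theorem lt_mul_simple_mul_simple_of_fix (h1 : 1 ≤ l) (hl : l + 1 < n) {x : Equiv.Perm (Fin n)}
    (hx : ∀ p : Fin n, l < p → x p = p) :
    length (x * simple n (l + 1)) < length (x * simple n (l + 1) * simple n l) := by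
  rw [length_lt_mul_simple_iff (i := l) ⟨h1, by omega⟩, Equiv.Perm.mul_apply,
    Equiv.Perm.mul_apply, simple_apply_of_ne _ (by simp; omega) (by simp)]
  have h2 : simple n (l + 1) ⟨l, by omega⟩ = ⟨l + 1, hl⟩ :=
    simple_apply_left (i := l + 1) ⟨by omega, hl⟩
  rw [h2, hx ⟨l + 1, hl⟩ (Nat.lt_succ_self l), Fin.lt_def]
  exact Nat.lt_succ_of_le (apply_le_of_fix hx (Nat.sub_le l 1))

/-- Elements of the support fix `l + 1`. This test discards the unwanted terms in all evaluations
below. -/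
theorem IsStrip.eq_zero {w : Equiv.Perm (Fin n)} {c : Equiv.Perm (Fin n) → ℚ[X]}
    (h : IsStrip l w c) (hl : l + 1 < n) {x : Equiv.Perm (Fin n)} {p : Fin n} (hp : (p : ℕ) ≤ l)
    (hx : x ⟨l + 1, hl⟩ = p) : c x = 0 := by
  by_contra hc
  have := congrArg Fin.val (hx.symm.trans (h.fix x hc ⟨l + 1, hl⟩ (Nat.lt_succ_self l)))
  simp only [] at this
  omega

theorem IsStrip.fix_self {w : Equiv.Perm (Fin n)} {c : Equiv.Perm (Fin n) → ℚ[X]}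
    (h : IsStrip l w c) : ∀ p : Fin n, l < p → w p = p :=
  h.fix w (by rw [h.self]; exact one_ne_zero)

/-- On the support `s_{l+1}` is always an ascent, so the weight `q` never occurs for the first
letter of the pair. -/
theorem IsStrip.mulStep_eq {w : Equiv.Perm (Fin n)} {c : Equiv.Perm (Fin n) → ℚ[X]}
    (h : IsStrip l w c) (hl : l + 1 < n) (y : Equiv.Perm (Fin n)) :
    mulStep (l + 1) c y = c y + c (y * simple n (l + 1)) := by
  have key : ∀ z, stepWeight (l + 1) z * c z = c z := by
    intro z
    by_cases hz : c z = 0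
    · rw [hz, mul_zero]
    · rw [stepWeight, if_pos (lt_mul_simple_of_fix hl (h.fix z hz)), one_mul]
  rw [mulStep, key, key]

theorem simple_succ_apply (hl : l + 1 < n) :
    simple n (l + 1) ⟨l + 1, hl⟩ = ⟨l, by omega⟩ :=
  simple_apply_right (i := l + 1) ⟨by omega, hl⟩

theorem simple_succ_apply_pred (h1 : 1 ≤ l) (hl : l + 1 < n) :
    simple n (l + 1) ⟨l - 1, by omega⟩ = ⟨l - 1, by omega⟩ :=
  simple_apply_of_ne _ (by simp; omega) (by simp)

theorem simple_apply_succ (hl : l + 1 < n) :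
    simple n l ⟨l + 1, hl⟩ = ⟨l + 1, hl⟩ :=
  simple_apply_of_ne _ (by simp; omega) (by simp)

/-- The new top element is reached only from `w` by keeping both letters, each time at an ascent;
the three other terms lie off the support. -/
theorem IsStrip.mulStep_mulStep_self {w : Equiv.Perm (Fin n)} {c : Equiv.Perm (Fin n) → ℚ[X]}
    (h : IsStrip l w c) (h1 : 1 ≤ l) (hl : l + 1 < n) :
    mulStep l (mulStep (l + 1) c) (w * simple n (l + 1) * simple n l) = 1 := by
  have ht := simple_apply_right (n := n) (i := l) ⟨h1, by omega⟩
  have e1 : c (w * simple n (l + 1) * simple n l) = 0 :=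
    h.eq_zero hl (apply_le_of_fix h.fix_self (p := ⟨l, by omega⟩) le_rfl) (by
      simp only [Equiv.Perm.mul_apply, simple_apply_succ, simple_succ_apply])
  have e2 : c (w * simple n (l + 1) * simple n l * simple n (l + 1)) = 0 :=
    h.eq_zero hl (apply_le_of_fix h.fix_self (p := ⟨l - 1, by omega⟩) (Nat.sub_le l 1)) (by
      simp only [Equiv.Perm.mul_apply, simple_succ_apply, ht, simple_succ_apply_pred h1 hl])
  have e3 : c (w * simple n (l + 1)) = 0 :=
    h.eq_zero hl (apply_le_of_fix h.fix_self (p := ⟨l, by omega⟩) le_rfl) (by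
      simp only [Equiv.Perm.mul_apply, simple_succ_apply])
  rw [mulStep, mul_simple_cancel, h.mulStep_eq hl, h.mulStep_eq hl, e1, e2, mul_simple_cancel, e3,
    h.self, stepWeight, stepWeight, mul_simple_cancel,
    if_pos (lt_mul_simple_mul_simple_of_fix h1 hl h.fix_self), zero_add, zero_add, mul_zero,
    one_mul, zero_add]

theorem IsStrip.length_mul_simple_mul_simple {w : Equiv.Perm (Fin n)}
    {c : Equiv.Perm (Fin n) → ℚ[X]} (h : IsStrip l w c) (h1 : 1 ≤ l) (hl : l + 1 < n) :
    length (w * simple n (l + 1) * simple n l) = length w + 2 := by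
  rw [length_mul_simple_eq ⟨h1, by omega⟩ (lt_mul_simple_mul_simple_of_fix h1 hl h.fix_self),
    length_mul_simple_eq ⟨by omega, hl⟩ (lt_mul_simple_of_fix hl h.fix_self)]

/-- Bounds the contribution of a single `y` to the coefficient at `v`. Working with each nonzero
coefficient instead of the degree lets contributions be added with no care for cancellation. -/
theorem IsStrip.degree_mulStep {w : Equiv.Perm (Fin n)} {c : Equiv.Perm (Fin n) → ℚ[X]}
    (h : IsStrip l w c) (h1 : 1 ≤ l) (hl : l + 1 < n) {y v : Equiv.Perm (Fin n)}
    (hv : v = y ∨ v = y * simple n l) (hne : v ≠ w * simple n (l + 1) * simple n l) {j : ℕ}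
    (hj : (stepWeight l y * mulStep (l + 1) c y).coeff j ≠ 0) :
    2 * j + length v + 1 ≤ length w + 2 := by
  have hl' : 1 ≤ l ∧ l < n := ⟨h1, by omega⟩
  rw [h.mulStep_eq hl, stepWeight] at hj
  have hw0 : ∀ j, (c w).coeff j ≠ 0 → j = 0 := by
    intro j hj
    rw [h.self, coeff_one] at hj
    by_contra h'
    exact hj (if_neg h')
  have hcz : ∀ z j, (c z).coeff j ≠ 0 → c z ≠ 0 := by
    intro z j hz h0
    rw [h0, coeff_zero] at hz
    exact hz rfl
  by_cases hy : length y < length (y * simple n l)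
  · have hlen : length v ≤ length y + 1 := by
      have := length_mul_simple_eq hl' hy
      rcases hv with rfl | rfl <;> omega
    rw [if_pos hy, one_mul, coeff_add] at hj
    by_cases hj1 : (c y).coeff j = 0
    · have hj2 : (c (y * simple n (l + 1))).coeff j ≠ 0 := by
        rwa [hj1, zero_add] at hj
      have hfix := h.fix _ (hcz _ _ hj2)
      have hlen2 := length_mul_simple_eq ⟨by omega, hl⟩ (lt_mul_simple_of_fix hl hfix)
      rw [mul_simple_cancel] at hlen2
      by_cases hyw : y * simple n (l + 1) = w
      · rw [hyw] at hj2 hlen2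
        have := hw0 j hj2
        rcases hv with rfl | rfl
        · omega
        -- Keeping both letters after `w` gives the new top element, which is excluded.
        · exact absurd (by rw [← hyw, mul_simple_cancel]) hne
      · have := h.degree _ j hyw hj2
        omega
    · by_cases hyw : y = w
      · subst hyw
        have := hw0 j hj1
        omega
      · have := h.degree _ j hyw hj1
        omega
  · have hlen : length v ≤ length y := by
      rcases hv with rfl | rfl
      · exact le_rfl
      · exact not_lt.1 hy
    rw [if_neg hy] at hj
    obtain ⟨i, rfl⟩ : ∃ i, j = i + 1 := Nat.exists_eq_succ_of_ne_zero (by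
      rintro rfl
      rw [coeff_X_mul_zero] at hj
      exact hj rfl)
    rw [coeff_X_mul, coeff_add] at hj
    by_cases hj1 : (c y).coeff i = 0
    · have hj2 : (c (y * simple n (l + 1))).coeff i ≠ 0 := by
        rwa [hj1, zero_add] at hj
      -- An element that acquired the letter `s_{l+1}` has `s_l` as an ascent, so it never receives
      -- the factor `q`.
      have := lt_mul_simple_mul_simple_of_fix h1 hl (h.fix _ (hcz _ _ hj2))
      rw [mul_simple_cancel] at this
      exact absurd this hy
    -- The ascent condition on `w` gives `y ≠ w`. The factor `q` adds `2` to the left side of the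
    -- bound, exactly the gain in length of the top element.
    · have := h.degree _ i (by rintro rfl; exact hy h.asc) hj1
      omega

theorem IsStrip.step {w : Equiv.Perm (Fin n)} {c : Equiv.Perm (Fin n) → ℚ[X]}
    (h : IsStrip l w c) (h1 : 1 ≤ l) (hl : l + 1 < n) :
    IsStrip (l + 1) (w * simple n (l + 1) * simple n l) (mulStep l (mulStep (l + 1) c)) where
  self := h.mulStep_mulStep_self h1 hl
  degree x j hx hj := by
    rw [h.length_mul_simple_mul_simple h1 hl]
    rw [mulStep, coeff_add] at hj
    by_cases hj1 : (stepWeight l x * mulStep (l + 1) c x).coeff j = 0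
    · rw [hj1, zero_add] at hj
      exact h.degree_mulStep h1 hl (Or.inr (mul_simple_cancel l x).symm) hx hj
    · exact h.degree_mulStep h1 hl (Or.inl rfl) hx hj1
  asc := by
    have ht := simple_apply_right (n := n) (i := l) ⟨h1, by omega⟩
    have hw := (length_lt_mul_simple_iff (i := l) ⟨h1, by omega⟩ w).1 h.asc
    rw [length_lt_mul_simple_iff (i := l + 1) ⟨by omega, hl⟩]
    -- At positions `l` and `l + 1` the new permutation has the values of `w` at `l - 1` and `l`, so
    -- the ascent is inherited.
    simpa only [Nat.add_sub_cancel, Equiv.Perm.mul_apply, ht, simple_apply_succ, simple_succ_apply,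
      simple_succ_apply_pred h1 hl] using hw
  fix x hx p hp := by
    have hs : simple n (l + 1) p = p := simple_apply_of_ne p (by omega) (by omega)
    have ht : simple n l p = p := simple_apply_of_ne p (by omega) (by omega)
    have key : ∀ y, mulStep (l + 1) c y ≠ 0 → y p = p := by
      intro y hy
      rw [h.mulStep_eq hl] at hy
      by_cases hc : c y = 0
      · rw [hc, zero_add] at hy
        have := h.fix _ hy p (by omega)
        rwa [Equiv.Perm.mul_apply, hs] at this
      · exact h.fix y hc p (by omega)
    rw [mulStep] at hx
    by_cases hc : mulStep (l + 1) c x = 0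
    · rw [hc, mul_zero, zero_add] at hx
      have := key _ (right_ne_zero_of_mul hx)
      rwa [Equiv.Perm.mul_apply, ht] at this
    · exact key x hc

/-- The identity is reached from itself at an ascent (weight `1`) and from `s_l` at a descent
(weight `q`). -/
theorem IsStrip.mulStep_mulStep_one {w : Equiv.Perm (Fin n)} {c : Equiv.Perm (Fin n) → ℚ[X]}
    (h : IsStrip l w c) (h1 : 1 ≤ l) (hl : l + 1 < n) :
    mulStep l (mulStep (l + 1) c) 1 = c 1 + X * c (simple n l) := by
  have hl' : 1 ≤ l ∧ l < n := ⟨h1, by omega⟩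
  have ht := simple_apply_right hl'
  have e1 : c (simple n (l + 1)) = 0 :=
    h.eq_zero hl (p := ⟨l, by omega⟩) le_rfl (simple_succ_apply hl)
  have e2 : c (simple n l * simple n (l + 1)) = 0 :=
    h.eq_zero hl (p := ⟨l - 1, by omega⟩) (Nat.sub_le l 1) (by
      rw [Equiv.Perm.mul_apply, simple_succ_apply, ht])
  rw [mulStep, one_mul, h.mulStep_eq hl, h.mulStep_eq hl, one_mul, e1, e2, stepWeight, stepWeight,
    one_mul, simple_mul_self, length_one, length_simple hl', if_pos one_pos, if_neg (by omega),
    add_zero, add_zero, one_mul]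

theorem IsStrip.mulStep_mulStep_simple {w : Equiv.Perm (Fin n)} {c : Equiv.Perm (Fin n) → ℚ[X]}
    (h : IsStrip l w c) (h1 : 1 ≤ l) (hl : l + 1 < n) :
    mulStep l (mulStep (l + 1) c) (simple n (l + 1)) = c 1 := by
  have ht := simple_apply_right (n := n) (i := l) ⟨h1, by omega⟩
  have e1 : c (simple n (l + 1)) = 0 :=
    h.eq_zero hl (p := ⟨l, by omega⟩) le_rfl (simple_succ_apply hl)
  have e2 : c (simple n (l + 1) * simple n l) = 0 :=
    h.eq_zero hl (p := ⟨l, by omega⟩) le_rfl (by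
      rw [Equiv.Perm.mul_apply, simple_apply_succ, simple_succ_apply])
  have e3 : c (simple n (l + 1) * simple n l * simple n (l + 1)) = 0 :=
    h.eq_zero hl (p := ⟨l - 1, by omega⟩) (Nat.sub_le l 1) (by
      rw [Equiv.Perm.mul_apply, Equiv.Perm.mul_apply, simple_succ_apply, ht,
        simple_succ_apply_pred h1 hl])
  have e4 := lt_mul_simple_mul_simple_of_fix h1 hl (x := 1) fun _ _ => rfl
  rw [one_mul] at e4
  rw [mulStep, h.mulStep_eq hl, h.mulStep_eq hl, simple_mul_self, e1, e2, e3, stepWeight,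
    if_pos e4, zero_add, one_mul, add_zero, mul_zero, add_zero]

theorem isStrip_one (hl : 1 ≤ l ∧ l < n) :
    IsStrip l (1 : Equiv.Perm (Fin n)) (Pi.single 1 1) where
  fix x hx p _ := by
    have : x = 1 := by
      by_contra h
      exact hx (Pi.single_eq_of_ne h 1)
    rw [this, Equiv.Perm.one_apply]
  asc := by rw [one_mul, length_one, length_simple hl]; exact one_pos
  self := Pi.single_eq_same 1 1
  degree x j hx hj := by
    rw [Pi.single_eq_of_ne hx, coeff_zero] at hj
    exact absurd rfl hj

end Strip

/-! ### The permutations `w_{k,l}` -/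

theorem haimanWord_self (k : ℕ) : haimanWord (k + 1) k = [] := by
  simp [haimanWord]

theorem haimanWord_succ (k m : ℕ) :
    haimanWord (k + 1) (k + (m + 1)) = haimanWord (k + 1) (k + m) ++ [k + m + 1, k + m] := by
  rw [haimanWord, haimanWord, show k + (m + 1) + 1 - (k + 1) = m + 1 by omega,
    show k + m + 1 - (k + 1) = m by omega, List.range'_concat, List.flatMap_append]
  simp [show k + 1 + m = k + m + 1 by omega]

/-- The start index is shifted to `k + 1` so that `m` counts pairs and the induction begins with the
empty word. The last conjunct says that the coefficient at `s_{k+m}` is `F_{m-1}`, in a form that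
covers `m = 0`, where this coefficient is `0`. -/
theorem isStrip_haimanWord {n k : ℕ} (hk : 1 ≤ k) (m : ℕ) (hm : k + m < n) :
    IsReducedExpression (wordProd n (haimanWord (k + 1) (k + m))) (haimanWord (k + 1) (k + m)) ∧
      IsStrip (k + m) (wordProd n (haimanWord (k + 1) (k + m)))
        (wordCoeff n (haimanWord (k + 1) (k + m))) ∧
      wordCoeff n (haimanWord (k + 1) (k + m)) 1 = qFib m ∧
      qFib m + X * wordCoeff n (haimanWord (k + 1) (k + m)) (simple n (k + m)) =
        qFib (m + 1) := by
  induction m with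
  | zero =>
    rw [add_zero] at hm ⊢
    rw [haimanWord_self, wordProd_nil, wordCoeff_nil]
    refine ⟨⟨by simp [IsExpression], rfl, by rw [length_one, List.length_nil]⟩,
      isStrip_one ⟨hk, hm⟩, Pi.single_eq_same 1 1, ?_⟩
    have : simple n k ≠ 1 := by
      intro h
      have := length_simple ⟨hk, hm⟩
      rw [h, length_one] at this
      omega
    rw [Pi.single_eq_of_ne this, mul_zero, add_zero]
    rfl
  | succ m ih =>
    obtain ⟨⟨h1, -, h2⟩, h3, h4, h5⟩ := ih (by omega)
    have hm' : k + m + 1 < n := hm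
    have hk' : 1 ≤ k + m := by omega
    have e1 : wordProd n (haimanWord (k + 1) (k + (m + 1))) =
        wordProd n (haimanWord (k + 1) (k + m)) * simple n (k + m + 1) * simple n (k + m) := by
      rw [haimanWord_succ, wordProd_append, wordProd_cons, wordProd_cons, wordProd_nil, mul_one,
        mul_assoc]
    have e2 : wordCoeff n (haimanWord (k + 1) (k + (m + 1))) =
        mulStep (k + m) (mulStep (k + m + 1) (wordCoeff n (haimanWord (k + 1) (k + m)))) := by
      rw [haimanWord_succ, List.append_cons, wordCoeff_concat, wordCoeff_concat]
    refine ⟨⟨?_, rfl, ?_⟩, ?_, ?_, ?_⟩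
    · rw [haimanWord_succ]
      intro i hi
      rcases List.mem_append.1 hi with hi | hi
      · exact h1 i hi
      · simp only [List.mem_cons, List.not_mem_nil, or_false] at hi
        omega
    · rw [e1, h3.length_mul_simple_mul_simple hk' hm', haimanWord_succ, List.length_append, h2]
      rfl
    · rw [e1, e2]
      exact h3.step hk' hm'
    · rw [e2, h3.mulStep_mulStep_one hk' hm', h4, h5]
    · rw [e2, ← add_assoc, h3.mulStep_mulStep_simple hk' hm', h4]
      rfl

end

end KazhdanLusztig

theorem corollary2 (n k l : ℕ) (hk : 2 ≤ k) (hkl : k < l) (hl : l < n) :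
    KazhdanLusztig.IsReducedExpression
        (KazhdanLusztig.wordProd n (KazhdanLusztig.haimanWord k l))
        (KazhdanLusztig.haimanWord k l) ∧
      KazhdanLusztig.klPoly 1 (KazhdanLusztig.wordProd n (KazhdanLusztig.haimanWord k l)) =
        KazhdanLusztig.qFib (l - k + 1) := by
  obtain ⟨k, rfl⟩ := Nat.exists_eq_add_of_le' (show 1 ≤ k by omega)
  obtain ⟨m, rfl⟩ := Nat.exists_eq_add_of_le (show k ≤ l by omega)
  obtain ⟨h1, h2, h3, -⟩ := KazhdanLusztig.isStrip_haimanWord (k := k) (by omega) m hl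
  refine ⟨h1, ?_⟩
  -- After the shift, `k < l` forces `m` to be positive, so the truncated subtraction in the index
  -- is exact.
  rw [KazhdanLusztig.klPoly_eq (KazhdanLusztig.isKLFamily_wordCoeff h1 h2.self h2.degree), h3,
    show k + m - (k + 1) + 1 = m by omega]
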